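/- Let $\epsilon\in\mathbb R$. On $\mathbb R^3$ with coordinates $(q,p,s)$ and contact form $\eta=ds-p\,dq$, the contact Hamiltonian vector field of a function $H$ is $$X_H=\frac{\partial H}{\partial p}\frac{\partial}{\partial q}+\Big(-p\frac{\partial H}{\partial s}-\frac{\partial H}{\partial q}\Big)\frac{\partial}{\partial p}+\Big(p\frac{\partial H}{\partial p}-H\Big)\frac{\partial}{\partial s}.$$ Split the van der Pol contact Hamiltonian $\mathcal H=ps-\epsilon(1-q^2)s+q$ as $\mathcal H=A+B+C$ with $A=-\epsilon(1-q^2)s$, $B=q$, $C=ps$. A contact splitting integrator $S(\tau)$ is a finite composition, in any order, of exact flow maps $e^{c_i\tau X_{h_i}}$ with $h_i\in\{A,B,C\}$ and $c_i\in\mathbb R$, such that for each of $A$, $B$, $C$ the coefficients $c_i$ belonging to it add up to $1$. (This includes the symmetric second order compositions $e^{\frac\tau2X_{1}}e^{\frac\tau2X_{2}}e^{\tau X_{3}}e^{\frac\tau2X_{2}}e^{\frac\tau2X_{1}}$ for every ordering of the pieces, and the compositions $S(w_1\tau)\cdots S(w_m\tau)$ of a contact splitting integrator $S$ with $\sum_j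 w_j=1$.) Its formal Lie series is the corresponding product of the formal exponentials $e^{c_i\tau X_{h_i}}$, acting on polynomial functions by pull-back. A modified Hamiltonian of $S(\tau)$ is a formal power series $\mathcal H_{mod}=\sum_{k\ge0}\tau^kH_k$ with coefficients $H_k\in\mathbb R[q,p,s]$ such that, as formal power series in $\tau$, $$S(\tau)=\exp\big(\tau X_{\mathcal H_{mod}}\big),\qquad X_{\mathcal H_{mod}}=\sum_{k\ge0}\tau^kX_{H_k},$$ that is, $\tau X_{\mathcal H_{mod}}$ is the logarithm of the product of exponentials that the Baker-Campbell-Hausdorff formula computes. Then every contact splitting integrator $S(\tau)$ has exactly one modified Hamiltonian $\mathcal H_{mod}$. The series $\exp(\tau X_{\mathcal H_{mod}})$ is the asymptotic expansion as $\tau\to0$ of the numerical map: for every polynomial $f$, every point $x$ and every $N$, the value $f(S(\tau)x)$ equals the truncation of $(\exp(\tau X_{\mathcal H_{mod}})f)(x)$ to the powers $\tau^k$ with $k<N$, up to $O(\tau^N)$. Moreover $H_0=\mathcal H$, and $\mathcal H_{mod}$ is linear in $p$: $\mathcal H_{mod}=a\,p+b$ with formal power series $a\ne0$ and $b$ in $\tau$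 whose coefficients are polynomials in $(q,s)$ only. Consequently the right-hand sides of the modified equations for $q$ and $s$, namely $$\dot q=\frac{\partial\mathcal H_{mod}}{\partial p},\qquad \dot s=p\,\frac{\partial\mathcal H_{mod}}{\partial p}-\mathcal H_{mod},$$ do not depend on $p$ (in each coefficient of the power series in $\tau$). -/

import Mathlib

namespace ContactVdP

noncomputable section

/-- Polynomial functions on `ℝ³` with Darboux coordinates `(q, p, s)`, which are the variables
`0`, `1`, `2`; the contact form is `η = ds - p dq`. -/
abbrev Obs : Type := MvPolynomial (Fin 3) ℝ

/-- The coordinate function `q`. -/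
abbrev q : Obs := MvPolynomial.X 0

/-- The coordinate function `p`. -/
abbrev p : Obs := MvPolynomial.X 1

/-- The coordinate function `s`. -/
abbrev s : Obs := MvPolynomial.X 2

/-- The contact Hamiltonian vector field
`X_H = (∂H/∂p) ∂/∂q + (-p ∂H/∂s - ∂H/∂q) ∂/∂p + (p ∂H/∂p - H) ∂/∂s`. -/
def contactVF (H : Obs) : Derivation ℝ Obs Obs :=
  (MvPolynomial.pderiv 1 H) • MvPolynomial.pderiv 0
    + (-(p * MvPolynomial.pderiv 2 H) - MvPolynomial.pderiv 0 H) • MvPolynomial.pderiv 1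
    + (p * MvPolynomial.pderiv 1 H - H) • MvPolynomial.pderiv 2

/-- Labels of the three pieces of the splitting. -/
inductive Piece : Type
  | A
  | B
  | C
  deriving DecidableEq

/-- The van der Pol splitting `A = -ε (1 - q²) s`, `B = q`, `C = p s`. -/
def Piece.ham (ε : ℝ) : Piece → Obs
  | .A => -(MvPolynomial.C ε * (1 - q ^ 2) * s)
  | .B => q
  | .C => p * s

/-- The van der Pol contact Hamiltonian `p s - ε (1 - q²) s + q`. -/
def vdpHam (ε : ℝ) : Obs := p * s - MvPolynomial.C ε * (1 - q ^ 2) * s + q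

/-- The exact time-`t` flow maps of the contact vector fields of `A`, `B`, `C` (see
`Piece.flow_zero` and `Piece.hasDerivAt_flow`); the flow of `C` is only local, it is the actual
flow as long as `1 + p t` does not vanish. -/
def Piece.flow (ε : ℝ) : Piece → ℝ → (Fin 3 → ℝ) → (Fin 3 → ℝ)
  | .A, t, x => ![x 0, Real.exp (ε * (1 - x 0 ^ 2) * t) * (x 1 - 2 * ε * x 0 * x 2 * t),
      Real.exp (ε * (1 - x 0 ^ 2) * t) * x 2]
  | .B, t, x => ![x 0, x 1 - t, x 2 - x 0 * t]
  | .C, t, x => ![x 0 + x 2 * t, x 1 / (1 + x 1 * t), x 2]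

theorem Piece.flow_zero (ε : ℝ) (h : Piece) (x : Fin 3 → ℝ) : h.flow ε 0 x = x := by
  cases h <;> ext i <;> fin_cases i <;> simp [Piece.flow]

/-- The maps `Piece.flow` solve the contact Hamiltonian equations of the pieces. -/
theorem Piece.hasDerivAt_flow (ε : ℝ) (h : Piece) (x : Fin 3 → ℝ) (t : ℝ)
    (ht : h = Piece.C → 1 + x 1 * t ≠ 0) (i : Fin 3) :
    HasDerivAt (fun u => h.flow ε u x i)
      (MvPolynomial.eval (h.flow ε t x) (contactVF (h.ham ε) (MvPolynomial.X i))) t := by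
  have e1 : ∀ (i j : Fin 3), MvPolynomial.pderiv (R := ℝ) i (MvPolynomial.X j) = if j = i then 1 else 0 := by
    intro i j; rw [MvPolynomial.pderiv_X]; simp [Pi.single_apply, eq_comm]
  cases h with
  | A =>
    have hE : HasDerivAt (fun u : ℝ => Real.exp (ε * (1 - x 0 ^ 2) * u))
        (Real.exp (ε * (1 - x 0 ^ 2) * t) * (ε * (1 - x 0 ^ 2))) t := by
      simpa using ((hasDerivAt_id t).const_mul (ε * (1 - x 0 ^ 2))).exp
    have hL : HasDerivAt (fun u : ℝ => x 1 - 2 * ε * x 0 * x 2 * u) (-(2 * ε * x 0 * x 2)) t := by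
      simpa using ((hasDerivAt_id t).const_mul (2 * ε * x 0 * x 2)).const_sub (x 1)
    fin_cases i
    · simpa [Piece.flow, Piece.ham, contactVF, e1] using hasDerivAt_const t (x 0)
    · refine (hE.mul hL).congr_deriv ?_
      simp [Piece.flow, Piece.ham, contactVF, e1]
      ring
    · refine (hE.mul_const (x 2)).congr_deriv ?_
      simp [Piece.flow, Piece.ham, contactVF, e1]
      ring
  | B =>
    fin_cases i
    · simpa [Piece.flow, Piece.ham, contactVF, e1] using hasDerivAt_const t (x 0)
    · simpa [Piece.flow, Piece.ham, contactVF, e1] using (hasDerivAt_id t).const_sub (x 1)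
    · simpa [Piece.flow, Piece.ham, contactVF, e1] using
        ((hasDerivAt_id t).const_mul (x 0)).const_sub (x 2)
  | C =>
    have hne := ht rfl
    fin_cases i
    · simpa [Piece.flow, Piece.ham, contactVF, e1] using
        ((hasDerivAt_id t).const_mul (x 2)).const_add (x 0)
    · have hD : HasDerivAt (fun u : ℝ => 1 + x 1 * u) (x 1) t := by
        simpa using ((hasDerivAt_id t).const_mul (x 1)).const_add 1
      refine ((hasDerivAt_const t (x 1)).div hD hne).congr_deriv ?_
      simp [Piece.flow, Piece.ham, contactVF, e1]
      field_simp
    · simpa [Piece.flow, Piece.ham, contactVF, e1] using hasDerivAt_const t (x 2)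

/-- A contact splitting integrator for `H = A + B + C`: a finite composition of the maps
`e^{c τ X_h}` with `h` one of `A`, `B`, `C` and real numbers `c`, in any order, listed in the
order in which they act on the initial condition, such that the coefficients belonging to each
piece add up to `1`.
This includes the second order integrators `e^{τ/2 X₁} e^{τ/2 X₂} e^{τ X₃} e^{τ/2 X₂} e^{τ/2 X₁}`
for all orderings of the pieces, and all compositions `S(w₁ τ) ⋯ S(w_m τ)` of a contact splitting
integrator `S` with `w₁ + ⋯ + w_m = 1`, such as those of Yoshida. -/
structure SplittingIntegrator where
  /-- The stages `(h, c)`, first stage first. -/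
  stages : List (Piece × ℝ)
  /-- Consistency with `H = A + B + C`. -/
  consistent : ∀ h : Piece, (stages.map fun st => if st.1 = h then st.2 else 0).sum = 1

/-- The numerical map `S(τ)` of `ℝ³`. -/
def SplittingIntegrator.step (S : SplittingIntegrator) (ε τ : ℝ) (x : Fin 3 → ℝ) : Fin 3 → ℝ :=
  S.stages.foldl (fun y st => st.1.flow ε (st.2 * τ) y) x

/-- Formal power series in the time step `τ` (the variable `PowerSeries.X`) whose coefficients
are linear operators on functions. -/
abbrev OpSeries : Type := PowerSeries (Module.End ℝ Obs)

/-- The formal exponential `∑ₙ Dⁿ / n!` of a series `D` with constant coefficient `0`: then only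
the terms with `n ≤ k` contribute to the coefficient of `τᵏ`. -/
def formalExp (D : OpSeries) : OpSeries :=
  PowerSeries.mk fun k =>
    ∑ n ∈ Finset.range (k + 1), ((n.factorial : ℝ)⁻¹) • PowerSeries.coeff k (D ^ n)

/-- The formal Lie series `e^{c₁ τ X_{h₁}} e^{c₂ τ X_{h₂}} ⋯` of a splitting integrator, acting
on functions by pull-back. As `(e^{t X} f)(x)` is `f` evaluated at the time-`t` flow of `x`, the
leftmost factor belongs to the map that is applied first. -/
def SplittingIntegrator.lieSeries (S : SplittingIntegrator) (ε : ℝ) : OpSeries :=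
  (S.stages.map fun st => formalExp
    (PowerSeries.X * PowerSeries.C (st.2 • (contactVF (st.1.ham ε)).toLinearMap))).prod

/-- The formal time-`τ` flow `exp (τ X_H)` of the contact vector field of a formal series
`H = ∑ₖ τᵏ Hₖ`, where `X_H = ∑ₖ τᵏ X_{Hₖ}`. -/
def formalFlow (H : PowerSeries Obs) : OpSeries :=
  formalExp (PowerSeries.X *
    PowerSeries.mk fun k => (contactVF (PowerSeries.coeff k H)).toLinearMap)

/-- `H` is a modified Hamiltonian of the integrator: `S(τ) = exp (τ X_H)` as formal series,
that is, `τ X_H` is the Baker-Campbell-Hausdorff logarithm of the product of exponentials. -/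
def IsModifiedHamiltonian (ε : ℝ) (S : SplittingIntegrator) (H : PowerSeries Obs) : Prop :=
  formalFlow H = S.lieSeries ε

/-- The right-hand side `∑ₖ τᵏ X_{Hₖ}(f)` of the equation for `df/dt` in the contact Hamiltonian
system of `H = ∑ₖ τᵏ Hₖ`; with `f = q`, `s`, `p` these are the modified equations. -/
def modifiedRHS (H : PowerSeries Obs) (f : Obs) : PowerSeries Obs :=
  PowerSeries.mk fun k => contactVF (PowerSeries.coeff k H) f

/-- No coefficient of the series depends on `p`. -/
def PFree (F : PowerSeries Obs) : Prop := ∀ k : ℕ, (1 : Fin 3) ∉ (PowerSeries.coeff k F).vars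

/-- `H = a p + b` with `a`, `b` independent of `p` and `a ≠ 0`. -/
def LinearInP (H : PowerSeries Obs) : Prop :=
  ∃ a b : PowerSeries Obs, PFree a ∧ PFree b ∧ a ≠ 0 ∧ H = a * PowerSeries.C p + b

/-- The operator series `T = ∑ₖ τᵏ Tₖ` is the asymptotic expansion of pull-back by the maps
`Φ τ` as `τ → 0`: `f (Φ τ x) = ∑_{k < N} τᵏ (Tₖ f)(x) + O(τᴺ)` for all `f`, `x`, `N`. -/
def IsExpansionOf (T : OpSeries) (Φ : ℝ → (Fin 3 → ℝ) → (Fin 3 → ℝ)) : Prop :=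
  ∀ (f : Obs) (x : Fin 3 → ℝ) (N : ℕ),
    (fun τ : ℝ => MvPolynomial.eval (Φ τ x) f
      - ∑ k ∈ Finset.range N, τ ^ k * MvPolynomial.eval x (PowerSeries.coeff k T f))
      =O[nhds 0] fun τ : ℝ => τ ^ N

end

end ContactVdP

namespace ContactVdP

open PowerSeries Finset Filter Topology Asymptotics

noncomputable section

/-! ### Formal series over a noncommutative ring: orders of vanishing, Euler operator, iterated
commutators -/

section FormalSeries

variable {A : Type*} [Ring A]

/-! Contact fields of Hamiltonians `a p + b`, with `a`, `b` polynomials in `q`, `s`, form a Lie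
algebra `linearFields` (`commutator_contactVF`) containing the fields of the three pieces. By
Baker-Campbell-Hausdorff the logarithm of the product of exponentials has its coefficients there, so
it is `τ X_H` with `H` linear in `p`.

No explicit BCH formula is used. For a commutator-closed subspace `L`, consider the series `U = 1 +
O(τ)` whose logarithmic derivative `(τ U') U⁻¹` has coefficients in `L`. They are closed under
products (`IsGroupLike.mul`), contain exponentials of series in `τ L[[τ]]`
(`isGroupLike_formalExp`), and are all of that form (`exists_formalExp_eq`).

Uniqueness holds because the formal exponential is injective and `X_H` determines `H`. Comparing
coefficients of `τ` gives `H₀`, and `∂H₀/∂p = s` gives `a ≠ 0`. The asymptotic expansion is a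
separate analytic fact: a Taylor estimate for each piece, locally uniform in the starting point
(`flow_taylor_isBigO`), is composed stage by stage (`IsExpansionOf.comp_flow`). -/

theorem X_pow_dvd_mul {f g : A⟦X⟧} {a b : ℕ} (hf : X ^ a ∣ f) (hg : X ^ b ∣ g) :
    X ^ (a + b) ∣ f * g := by
  obtain ⟨f', rfl⟩ := hf
  obtain ⟨g', rfl⟩ := hg
  refine ⟨f' * g', ?_⟩
  rw [pow_add, mul_assoc, mul_assoc, ← mul_assoc f', ← X_pow_mul, mul_assoc]

theorem X_pow_dvd_pow {D : A⟦X⟧} (hD : X ∣ D) (n : ℕ) : X ^ n ∣ D ^ n := by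
  induction n with
  | zero => simp
  | succ n ih => exact pow_succ D n ▸ X_pow_dvd_mul ih (by simpa using hD)

/-- Each extra factor `D` or `E` gains one order. Hence a change of the exponent at order `k`
affects the exponential at that order only through its linear term. -/
theorem X_pow_dvd_pow_sub_pow {D E : A⟦X⟧} {k : ℕ} (hD : X ∣ D) (hE : X ∣ E)
    (h : X ^ k ∣ D - E) (n : ℕ) : X ^ (k + n) ∣ D ^ (n + 1) - E ^ (n + 1) := by
  induction n with
  | zero => simpa using h
  | succ n ih =>
    have e : D ^ (n + 1 + 1) - E ^ (n + 1 + 1)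
        = D * (D ^ (n + 1) - E ^ (n + 1)) + (D - E) * E ^ (n + 1) := by
      rw [pow_succ' D, pow_succ' E (n + 1)]
      noncomm_ring
    rw [e]
    refine dvd_add ?_ (X_pow_dvd_mul h (X_pow_dvd_pow hE _))
    have := X_pow_dvd_mul (a := 1) (by simpa using hD) ih
    rwa [show 1 + (k + n) = k + (n + 1) by ring] at this

/-- The Euler operator `τ d/dτ` on formal power series. -/
def euler (U : A⟦X⟧) : A⟦X⟧ := PowerSeries.mk fun n => n • coeff n U

@[simp] theorem coeff_euler (U : A⟦X⟧) (n : ℕ) : coeff n (euler U) = n • coeff n U := by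
  simp [euler]

theorem euler_mul (U V : A⟦X⟧) : euler (U * V) = euler U * V + U * euler V := by
  ext n
  simp only [coeff_euler, map_add, coeff_mul, smul_sum, ← sum_add_distrib]
  refine sum_congr rfl fun ij hij => ?_
  rw [← mem_antidiagonal.1 hij, smul_mul_assoc, mul_smul_comm, add_smul]

theorem euler_sum {ι : Type*} (t : Finset ι) (f : ι → A⟦X⟧) :
    euler (∑ i ∈ t, f i) = ∑ i ∈ t, euler (f i) := by
  ext n
  simp [smul_sum]

@[simp] theorem euler_one : euler (1 : A⟦X⟧) = 0 := by
  ext n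
  rcases n with _ | n <;> simp [coeff_one]

@[simp] theorem euler_C (w : A) : euler (C w : A⟦X⟧) = 0 := by
  ext n
  rcases n with _ | n <;> simp [coeff_C]

theorem X_dvd_euler (U : A⟦X⟧) : X ∣ euler U := by
  rw [X_dvd_iff, ← coeff_zero_eq_constantCoeff_apply]
  simp

/-- Iterated commutators `[D, [D, ⋯ [D, E]]]`. -/
def adPow (D E : A⟦X⟧) : ℕ → A⟦X⟧
  | 0 => E
  | k + 1 => D * adPow D E k - adPow D E k * D

theorem X_pow_dvd_adPow {D E : A⟦X⟧} (hD : X ∣ D) (hE : X ∣ E) (k : ℕ) :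
    X ^ (k + 1) ∣ adPow D E k := by
  induction k with
  | zero => simpa [adPow] using hE
  | succ k ih =>
    have hD' : X ^ 1 ∣ D := by simpa using hD
    exact dvd_sub (add_comm 1 (k + 1) ▸ X_pow_dvd_mul hD' ih) (X_pow_dvd_mul ih hD')

/-- Every `D` standing left of the differentiated factor is moved to the right by `D Y = [D, Y] + Y
D`; the multiplicities obey Pascal's rule. -/
theorem euler_pow (D : A⟦X⟧) (n : ℕ) :
    euler (D ^ n) = ∑ k ∈ range n, n.choose (k + 1) • (adPow D (euler D) k * D ^ (n - (k + 1))) := by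
  induction n with
  | zero => simp
  | succ n ih =>
    have h1 : ∀ k ∈ range n, D * n.choose (k + 1) • (adPow D (euler D) k * D ^ (n - (k + 1)))
        = n.choose (k + 1) • (adPow D (euler D) (k + 1) * D ^ (n - (k + 1)))
          + n.choose (k + 1) • (adPow D (euler D) k * D ^ (n - k)) := by
      intro k hk
      have : n - k = (n - (k + 1)) + 1 := by have := mem_range.1 hk; omega
      rw [this, pow_succ', mul_smul_comm, ← smul_add, adPow]
      noncomm_ring
    rw [pow_succ', euler_mul, ih, mul_sum, sum_congr rfl h1, sum_add_distrib]
    have h2 : ∀ k ∈ range (n + 1),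
        (n + 1).choose (k + 1) • (adPow D (euler D) k * D ^ (n + 1 - (k + 1)))
        = n.choose k • (adPow D (euler D) k * D ^ (n - k))
          + n.choose (k + 1) • (adPow D (euler D) k * D ^ (n - k)) := by
      intro k _
      rw [Nat.choose_succ_succ, add_smul, Nat.add_sub_add_right]
    rw [sum_congr rfl h2, sum_add_distrib,
      sum_range_succ' (fun k => n.choose k • (adPow D (euler D) k * D ^ (n - k))),
      sum_range_succ (fun k => n.choose (k + 1) • (adPow D (euler D) k * D ^ (n - k)))]
    simp [adPow]
    abel

theorem coeff_commutator (V W : A⟦X⟧) (n : ℕ) : coeff n (V * W - W * V)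
    = ∑ ij ∈ antidiagonal n, (coeff ij.1 V * coeff ij.2 W - coeff ij.2 W * coeff ij.1 V) := by
  rw [map_sub, coeff_mul, coeff_mul, sum_sub_distrib,
    ← Nat.sum_antidiagonal_swap (f := fun ij => coeff ij.1 W * coeff ij.2 V)]
  rfl

theorem isUnit_of_constantCoeff_eq_one {U : A⟦X⟧} (h : constantCoeff U = 1) : IsUnit U :=
  isUnit_iff_constantCoeff.2 (h ▸ isUnit_one)

theorem coeff_zero_of_euler_eq {U W : A⟦X⟧} (h : constantCoeff U = 1) (hW : euler U = W * U) :
    coeff 0 W = 0 := by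
  have := congrArg (coeff 0) hW
  simpa [h] using this.symm

/-! ### Commutator-closed subspaces and group-like series -/

variable [Algebra ℝ A]

/-- Formal power series with all coefficients in a given subspace. -/
def coeffsIn (L : Submodule ℝ A) : Submodule ℝ A⟦X⟧ where
  carrier := {W | ∀ n, coeff n W ∈ L}
  zero_mem' n := by simp
  add_mem' ha hb n := by simpa using L.add_mem (ha n) (hb n)
  smul_mem' c W h n := by simpa using L.smul_mem c (h n)

theorem euler_mem_coeffsIn {L : Submodule ℝ A} {W : A⟦X⟧} (h : W ∈ coeffsIn L) :
    euler W ∈ coeffsIn L := fun n => by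
  simpa using L.smul_of_tower_mem n (h n)

/-- A subspace of an associative algebra that is closed under commutators. -/
def CommutatorClosed (L : Submodule ℝ A) : Prop :=
  ∀ x ∈ L, ∀ y ∈ L, x * y - y * x ∈ L

theorem CommutatorClosed.coeffsIn {L : Submodule ℝ A} (hL : CommutatorClosed L) :
    CommutatorClosed (coeffsIn L) := fun V hV W hW n => by
  rw [coeff_commutator]
  exact L.sum_mem fun ij _ => hL _ (hV _) _ (hW _)

theorem adPow_mem {L : Submodule ℝ A} (hL : CommutatorClosed L) {D E : A⟦X⟧}
    (hD : D ∈ coeffsIn L) (hE : E ∈ coeffsIn L) (k : ℕ) : adPow D E k ∈ coeffsIn L := by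
  induction k with
  | zero => exact hE
  | succ k ih => exact hL.coeffsIn _ hD _ ih

/-- Formal series `U = 1 + O(τ)` whose logarithmic derivative has coefficients in `L`: if `L` is
closed under commutators, these are the exponentials of series in `τ L[[τ]]`. -/
structure IsGroupLike (L : Submodule ℝ A) (U : A⟦X⟧) : Prop where
  constantCoeff_eq : constantCoeff U = 1
  exists_log_deriv : ∃ W ∈ coeffsIn L, euler U = W * U

/-- The conjugate `Y = u w u⁻¹` solves `τ Y' = [W, Y]`. As `W` has no constant term, `n Yₙ` is a sum
of commutators of coefficients of `W` with earlier `Yⱼ`, and induction applies after dividing by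
`n`. -/
theorem coeff_conj_C_mem {L : Submodule ℝ A} (hL : CommutatorClosed L) (u : A⟦X⟧ˣ)
    (hu : IsGroupLike L (u : A⟦X⟧)) {w : A} (hw : w ∈ L) (n : ℕ) :
    coeff n ((u : A⟦X⟧) * C w * (↑u⁻¹ : A⟦X⟧)) ∈ L := by
  obtain ⟨W, hW, hWu⟩ := hu.exists_log_deriv
  have hW0 := coeff_zero_of_euler_eq hu.constantCoeff_eq hWu
  set Y := (u : A⟦X⟧) * C w * (↑u⁻¹ : A⟦X⟧) with hY
  have hYu : Y * (u : A⟦X⟧) = u * C w := by simp [hY, mul_assoc]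
  have hYe : euler Y = W * Y - Y * W := by
    have h1 : euler (Y * (u : A⟦X⟧)) = W * Y * (u : A⟦X⟧) := by
      rw [hYu, euler_mul, hWu, euler_C, mul_zero, add_zero, mul_assoc, ← hYu]
      exact (mul_assoc _ _ _).symm
    rw [euler_mul, hWu, ← mul_assoc] at h1
    have h2 : euler Y * (u : A⟦X⟧) = (W * Y - Y * W) * u := by
      rw [sub_mul, ← h1]; abel
    exact u.isUnit.mul_right_cancel h2
  induction n using Nat.strong_induction_on with
  | _ n ih =>
    rcases Nat.eq_zero_or_pos n with rfl | hn
    · have h1 : constantCoeff (↑u⁻¹ : A⟦X⟧) = 1 := by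
        have := congrArg constantCoeff u.mul_inv
        rwa [map_mul, hu.constantCoeff_eq, one_mul, map_one] at this
      simpa [hY, hu.constantCoeff_eq, h1] using hw
    · have h1 : n • coeff n Y ∈ L := by
        rw [← coeff_euler, hYe, coeff_commutator]
        refine L.sum_mem fun ij hij => ?_
        have hij := HasAntidiagonal.mem_antidiagonal.1 hij
        rcases Nat.eq_zero_or_pos ij.1 with h0 | h0
        · simp only [h0, hW0, zero_mul, mul_zero, sub_zero, L.zero_mem]
        · exact hL _ (hW _) _ (ih _ (by omega))
      have h2 : coeff n Y = (n : ℝ)⁻¹ • (n • coeff n Y) := by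
        rw [← Nat.cast_smul_eq_nsmul ℝ, smul_smul, inv_mul_cancel₀ (by positivity), one_smul]
      rw [h2]
      exact L.smul_mem _ h1

theorem conj_mem_coeffsIn {L : Submodule ℝ A} (hL : CommutatorClosed L) (u : A⟦X⟧ˣ)
    (hu : IsGroupLike L (u : A⟦X⟧)) {W : A⟦X⟧} (hW : W ∈ coeffsIn L) :
    (u : A⟦X⟧) * W * (↑u⁻¹ : A⟦X⟧) ∈ coeffsIn L := by
  intro n
  induction n generalizing W with
  | zero =>
    have := coeff_conj_C_mem hL u hu (hW 0) 0
    simpa using this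
  | succ n ih =>
    -- `X` is central, so it passes through the conjugation: the shifted series is handled by
    -- induction, the constant term by the previous lemma.
    rw [eq_X_mul_shift_add_const W, mul_add, add_mul, map_add, ← mul_assoc,
      (commute_X (u : A⟦X⟧)).eq, mul_assoc, mul_assoc, coeff_succ_X_mul, ← mul_assoc]
    refine L.add_mem (ih fun k => by simpa using hW (k + 1)) ?_
    rw [← coeff_zero_eq_constantCoeff_apply]
    exact coeff_conj_C_mem hL u hu (hW 0) _

/-- Logarithmic derivatives satisfy a twisted Leibniz rule: that of `U V` is `W + U Z U⁻¹`. -/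
theorem IsGroupLike.mul {L : Submodule ℝ A} (hL : CommutatorClosed L) {U V : A⟦X⟧}
    (hU : IsGroupLike L U) (hV : IsGroupLike L V) : IsGroupLike L (U * V) := by
  refine ⟨by simp [hU.constantCoeff_eq, hV.constantCoeff_eq], ?_⟩
  obtain ⟨u, rfl⟩ := isUnit_of_constantCoeff_eq_one hU.constantCoeff_eq
  obtain ⟨W, hW, hWU⟩ := hU.exists_log_deriv
  obtain ⟨Z, hZ, hZV⟩ := hV.exists_log_deriv
  refine ⟨W + u * Z * (↑u⁻¹ : A⟦X⟧), Submodule.add_mem _ hW (conj_mem_coeffsIn hL u hU hZ), ?_⟩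
  rw [euler_mul, hWU, hZV, add_mul]
  simp only [mul_assoc, Units.inv_mul_cancel_left]

theorem IsGroupLike.one (L : Submodule ℝ A) : IsGroupLike L (1 : A⟦X⟧) :=
  ⟨by simp, 0, Submodule.zero_mem _, by simp⟩

theorem IsGroupLike.list_prod {L : Submodule ℝ A} (hL : CommutatorClosed L) (l : List A⟦X⟧)
    (h : ∀ U ∈ l, IsGroupLike L U) : IsGroupLike L l.prod := by
  induction l with
  | nil => exact .one L
  | cons U l ih =>
    rw [List.prod_cons]
    exact (h U (by simp)).mul hL (ih fun V hV => h V (by simp [hV]))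

/-! ### Derivative of the truncated exponential -/

/-- The partial sums of the exponential series. -/
def expTrunc (N : ℕ) (D : A⟦X⟧) : A⟦X⟧ := ∑ n ∈ range N, ((n.factorial : ℝ)⁻¹) • D ^ n

theorem euler_smul (c : ℝ) (U : A⟦X⟧) : euler (c • U) = c • euler U := by
  ext n
  simp [smul_comm]

theorem X_pow_dvd_smul {n : ℕ} {U : A⟦X⟧} (c : ℝ) (h : X ^ n ∣ U) : X ^ n ∣ c • U := by
  rw [X_pow_dvd_iff] at h ⊢
  intro m hm
  simp [h m hm]

/-- The partial sums of `∑ₖ ad_D^k (τ dD/dτ) / (k + 1)!`. -/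
def dexpTrunc (N : ℕ) (D : A⟦X⟧) : A⟦X⟧ :=
  ∑ k ∈ range N, (((k + 1).factorial : ℝ)⁻¹) • adPow D (euler D) k

/-- Setting `n = k + m + 1` in the formula for powers, `(n choose k+1) / n!` splits as `1/(k+1)! ·
1/m!`. -/
theorem euler_expTrunc (N : ℕ) (D : A⟦X⟧) : euler (expTrunc N D)
    = ∑ km ∈ range N ×ˢ range N with km.1 + km.2 + 1 < N,
      ((((km.1 + 1).factorial : ℝ)⁻¹) • adPow D (euler D) km.1)
        * (((km.2.factorial : ℝ)⁻¹) • D ^ km.2) := by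
  simp only [expTrunc, euler_sum, euler_smul, euler_pow, smul_sum]
  rw [sum_sigma']
  refine sum_nbij' (fun x => (x.2, x.1 - (x.2 + 1))) (fun y => ⟨y.1 + y.2 + 1, y.1⟩) ?_ ?_ ?_ ?_ ?_
  · rintro ⟨n, k⟩ h
    simp at h ⊢
    omega
  · rintro ⟨k, m⟩ h
    simp at h ⊢
    omega
  · rintro ⟨n, k⟩ h
    simp at h ⊢
    omega
  · rintro ⟨k, m⟩ _
    simp
  · rintro ⟨n, k⟩ h
    simp only [mem_sigma, mem_range] at h
    obtain ⟨m, rfl⟩ : ∃ m, n = m + (k + 1) := ⟨n - (k + 1), by omega⟩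
    simp only [Nat.add_sub_cancel]
    rw [smul_mul_assoc, mul_smul_comm, smul_smul, ← Nat.cast_smul_eq_nsmul ℝ, smul_smul]
    congr 1
    have h1 := Nat.factorial_ne_zero m
    have h2 := Nat.factorial_ne_zero (k + 1)
    have h3 : (m + (k + 1)).choose (k + 1) ≠ 0 := (Nat.choose_pos (by omega)).ne'
    rw [← Nat.add_choose_mul_factorial_mul_factorial m (k + 1)]
    push_cast
    field_simp

/-- The product of truncations runs over the whole square of pairs `(k, m)`, the derivative only
over `k + m + 1 < N`. Each surplus term has order at least `(k + 1) + m ≥ N`. -/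
theorem X_pow_dvd_euler_expTrunc_sub (N : ℕ) {D : A⟦X⟧} (hD : X ∣ D) :
    X ^ N ∣ euler (expTrunc N D) - dexpTrunc N D * expTrunc N D := by
  rw [euler_expTrunc, dexpTrunc, expTrunc, sum_mul_sum, ← sum_product', dvd_sub_comm,
    ← sum_filter_add_sum_filter_not _ (fun km : ℕ × ℕ => km.1 + km.2 + 1 < N), add_sub_cancel_left]
  refine dvd_sum fun km hkm => ?_
  rw [mem_filter, not_lt] at hkm
  rw [smul_mul_assoc, mul_smul_comm]
  refine X_pow_dvd_smul _ (X_pow_dvd_smul _ ((pow_dvd_pow X hkm.2).trans ?_))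
  rw [add_right_comm]
  exact X_pow_dvd_mul (X_pow_dvd_adPow hD (X_dvd_euler D) _) (X_pow_dvd_pow hD _)

theorem dexpTrunc_mem {L : Submodule ℝ A} (hL : CommutatorClosed L) (N : ℕ) {D : A⟦X⟧}
    (hD : D ∈ coeffsIn L) : dexpTrunc N D ∈ coeffsIn L :=
  Submodule.sum_mem _ fun _ _ =>
    Submodule.smul_mem _ _ (adPow_mem hL hD (euler_mem_coeffsIn hD) _)

end FormalSeries

/-! ### Formal exponential and logarithm -/

theorem coeff_formalExp {D : OpSeries} (hD : X ∣ D) {k N : ℕ} (h : k < N) :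
    coeff k (formalExp D) = coeff k (expTrunc N D) := by
  simp only [formalExp, coeff_mk, expTrunc, map_sum]
  change _ = ∑ n ∈ range N, ((n.factorial : ℝ)⁻¹) • coeff k (D ^ n)
  refine sum_subset (fun n hn => ?_) fun n _ hn => ?_
  · rw [mem_range] at hn ⊢; omega
  · rw [mem_range, not_lt] at hn
    rw [X_pow_dvd_iff.1 (X_pow_dvd_pow hD n) k (by omega), smul_zero]

theorem X_pow_dvd_formalExp_sub {D : OpSeries} (hD : X ∣ D) (N : ℕ) :
    X ^ N ∣ formalExp D - expTrunc N D := by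
  rw [X_pow_dvd_iff]
  intro k hk
  rw [map_sub, coeff_formalExp hD hk, sub_self]

theorem constantCoeff_formalExp (D : OpSeries) : constantCoeff (formalExp D) = 1 := by
  rw [← coeff_zero_eq_constantCoeff_apply]
  simp [formalExp]

/-- Modulo `τⁿ⁺¹` the logarithmic derivative of `exp D` is the truncated series in iterated
commutators `ad_D^k (τ D')`, whose coefficients lie in `L`. -/
theorem isGroupLike_formalExp {L : Submodule ℝ (Module.End ℝ Obs)} (hL : CommutatorClosed L)
    {D : OpSeries} (hX : X ∣ D) (hD : D ∈ coeffsIn L) : IsGroupLike L (formalExp D) := by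
  refine ⟨constantCoeff_formalExp D, ?_⟩
  obtain ⟨u, hu⟩ := isUnit_of_constantCoeff_eq_one (constantCoeff_formalExp D)
  refine ⟨euler (formalExp D) * (↑u⁻¹ : OpSeries), fun n => ?_,
    by rw [← hu, mul_assoc, u.inv_mul, mul_one]⟩
  have key : X ^ (n + 1) ∣ euler (formalExp D) * (↑u⁻¹ : OpSeries) - dexpTrunc (n + 1) D := by
    have e : euler (formalExp D) * (↑u⁻¹ : OpSeries) - dexpTrunc (n + 1) D
        = (euler (formalExp D) - dexpTrunc (n + 1) D * formalExp D) * (↑u⁻¹ : OpSeries) := by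
      rw [sub_mul, mul_assoc (dexpTrunc (n + 1) D), ← hu, u.mul_inv, mul_one]
    rw [e]
    refine Dvd.dvd.mul_right ?_ _
    have h1 := X_pow_dvd_formalExp_sub hX (n + 1)
    have h2 : X ^ (n + 1) ∣ euler (formalExp D) - euler (expTrunc (n + 1) D) := by
      rw [X_pow_dvd_iff] at h1 ⊢
      intro m hm
      rw [map_sub, coeff_euler, coeff_euler, ← nsmul_sub, ← map_sub, h1 m hm, nsmul_zero]
    -- Divisibility here means a left factor, so multiplying by `dexpTrunc` on the left uses the
    -- centrality of `X`.
    have h3 := X_pow_dvd_mul (a := 0) (f := dexpTrunc (n + 1) D) (by simp) h1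
    rw [zero_add] at h3
    have h4 := dvd_sub (dvd_add h2 (X_pow_dvd_euler_expTrunc_sub (n + 1) hX)) h3
    convert h4 using 1
    rw [mul_sub]
    abel
  have := X_pow_dvd_iff.1 key n (by omega)
  rw [map_sub, sub_eq_zero] at this
  rw [this]
  exact dexpTrunc_mem hL _ hD n

/-- The coefficient of `τᵏ` in `exp D` is that of `D` up to a function of the lower ones. -/
theorem coeff_formalExp_sub {D E : OpSeries} (hD : X ∣ D) (hE : X ∣ E) {k : ℕ}
    (h : X ^ k ∣ D - E) {j : ℕ} (hj : j ≤ k) :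
    coeff j (formalExp D) - coeff j (formalExp E) = coeff j D - coeff j E := by
  -- Truncating at `j + 2` keeps the constant and linear terms even for `j = 0`; all higher powers
  -- differ beyond order `k`.
  rw [coeff_formalExp hD (show j < j + 2 by omega), coeff_formalExp hE (show j < j + 2 by omega),
    expTrunc, expTrunc, ← map_sub, ← sum_sub_distrib, sum_range_succ', sum_range_succ', map_add,
    map_add, map_sum, sum_eq_zero fun n _ => ?_]
  · simp
  · rw [← smul_sub]
    exact X_pow_dvd_iff.1 (X_pow_dvd_smul _ (X_pow_dvd_pow_sub_pow hD hE h (n + 1))) j (by omega)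

theorem formalExp_injective {D E : OpSeries} (hD : X ∣ D) (hE : X ∣ E)
    (h : formalExp D = formalExp E) : D = E := by
  have key : ∀ k, X ^ k ∣ D - E := by
    intro k
    induction k with
    | zero => simp
    | succ k ih =>
      rw [X_pow_dvd_iff]
      intro m hm
      rw [map_sub, ← coeff_formalExp_sub hD hE ih (by omega), h, sub_self]
  ext1 n
  have := X_pow_dvd_iff.1 (key (n + 1)) n (by omega)
  rwa [map_sub, sub_eq_zero] at this

/-- The coefficients of the formal logarithm of `U`. -/
def logCoeff (U : OpSeries) : ℕ → Module.End ℝ Obs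
  | 0 => 0
  | k + 1 => coeff (k + 1) U
      - coeff (k + 1) (formalExp (PowerSeries.mk fun j => if j < k + 1 then logCoeff U j else 0))

/-- The logarithm `D` is solved for order by order. To see `Dₙ ∈ L`, let `Eₙ` be `D` cut off below
order `n`, with coefficients in `L` by induction. The logarithmic derivatives `W` of `U` and `Z` of
`exp Eₙ` first differ at order `n`, where `Wₙ - Zₙ = n Dₙ`. -/
theorem exists_formalExp_eq {L : Submodule ℝ (Module.End ℝ Obs)} (hL : CommutatorClosed L)
    {U : OpSeries} (hU : IsGroupLike L U) :
    ∃ D : OpSeries, X ∣ D ∧ D ∈ coeffsIn L ∧ formalExp D = U := by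
  set D : OpSeries := PowerSeries.mk (logCoeff U) with hDdef
  set E : ℕ → OpSeries := fun k => PowerSeries.mk fun j => if j < k then logCoeff U j else 0
    with hEdef
  have hX : X ∣ D := by
    rw [X_dvd_iff, ← coeff_zero_eq_constantCoeff_apply]
    simp [hDdef, logCoeff]
  have hXE : ∀ k, X ∣ E k := fun k => by
    rw [X_dvd_iff, ← coeff_zero_eq_constantCoeff_apply]
    simp [hEdef, logCoeff]
  have hDE : ∀ k, X ^ k ∣ D - E k := fun k => by
    rw [X_pow_dvd_iff]
    intro m hm
    simp [hDdef, hEdef, hm]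
  have hexp : formalExp D = U := by
    ext1 k
    rcases k with _ | k
    · rw [coeff_zero_eq_constantCoeff_apply, coeff_zero_eq_constantCoeff_apply,
        constantCoeff_formalExp, hU.constantCoeff_eq]
    · have h1 := coeff_formalExp_sub hX (hXE (k + 1)) (hDE (k + 1)) le_rfl
      have h2 : coeff (k + 1) (E (k + 1)) = 0 := by simp [hEdef]
      have h3 : coeff (k + 1) D = coeff (k + 1) U - coeff (k + 1) (formalExp (E (k + 1))) := by
        simp only [hDdef, coeff_mk]
        rw [logCoeff]
      rw [h2, h3, sub_zero] at h1
      exact sub_left_inj.1 h1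
  refine ⟨D, hX, fun n => ?_, hexp⟩
  induction n using Nat.strong_induction_on with
  | _ n ih =>
    rcases Nat.eq_zero_or_pos n with rfl | hn
    · simp [hDdef, logCoeff]
    have hE : E n ∈ coeffsIn L := fun j => by
      by_cases hj : j < n
      · simpa [hEdef, hj, hDdef] using ih j hj
      · simp [hEdef, hj]
    obtain ⟨W, hW, hWU⟩ := hU.exists_log_deriv
    obtain ⟨hc, Z, hZ, hZE⟩ := isGroupLike_formalExp hL (hXE n) hE
    obtain ⟨u, hu⟩ := isUnit_of_constantCoeff_eq_one hc
    have hW0 := coeff_zero_of_euler_eq hU.constantCoeff_eq hWU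
    have hdiff : X ^ n ∣ U - formalExp (E n) := by
      rw [X_pow_dvd_iff]
      intro m hm
      rw [← hexp, map_sub, coeff_formalExp_sub hX (hXE n) (hDE n) hm.le, ← map_sub]
      exact X_pow_dvd_iff.1 (hDE n) m hm
    have hn_coeff : coeff n (U - formalExp (E n)) = coeff n D := by
      rw [← hexp, map_sub, coeff_formalExp_sub hX (hXE n) (hDE n) le_rfl]
      simp [hEdef]
    have e : (W - Z) * formalExp (E n)
        = euler (U - formalExp (E n)) - W * (U - formalExp (E n)) := by
      have : euler (U - formalExp (E n)) = euler U - euler (formalExp (E n)) := by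
        ext1 m; simp [smul_sub]
      rw [this, hWU, hZE, sub_mul, mul_sub]
      abel
    have hXW : X ^ 1 ∣ W := by
      rw [pow_one, X_dvd_iff, ← coeff_zero_eq_constantCoeff_apply, hW0]
    -- The factor `W` raises the order of `U - exp Eₙ` beyond `n`, so only the Euler term survives,
    -- and it multiplies by `n`.
    have h1 : coeff n ((W - Z) * formalExp (E n)) = n • coeff n D := by
      rw [e, map_sub, coeff_euler, hn_coeff,
        X_pow_dvd_iff.1 (X_pow_dvd_mul hXW hdiff) n (by omega), sub_zero]
    have h2 : X ^ n ∣ W - Z := by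
      have h3 : X ^ n ∣ (W - Z) * formalExp (E n) := by
        rw [e]
        refine dvd_sub ?_ ((pow_dvd_pow X (by omega)).trans (X_pow_dvd_mul hXW hdiff))
        rw [X_pow_dvd_iff] at hdiff ⊢
        intro m hm
        rw [coeff_euler, hdiff m hm, smul_zero]
      have h4 : W - Z = (W - Z) * formalExp (E n) * (↑u⁻¹ : OpSeries) := by
        rw [← hu, mul_assoc, u.mul_inv, mul_one]
      rw [h4]
      exact h3.mul_right _
    have h5 : coeff n ((W - Z) * formalExp (E n)) = coeff n (W - Z) := by
      obtain ⟨R, hR⟩ := h2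
      rw [hR, mul_assoc]
      have := coeff_X_pow_mul R n 0
      have h6 := coeff_X_pow_mul (R * formalExp (E n)) n 0
      rw [zero_add] at this h6
      rw [this, h6]
      simp [constantCoeff_formalExp]
    have h6 : n • coeff n D ∈ L := by
      rw [← h1, h5]
      exact (Submodule.sub_mem _ hW hZ) n
    have h7 : coeff n D = (n : ℝ)⁻¹ • (n • coeff n D) := by
      rw [← Nat.cast_smul_eq_nsmul ℝ, smul_smul, inv_mul_cancel₀ (by positivity), one_smul]
    rw [h7]
    exact L.smul_mem _ h6

/-! ### The Lie algebra of contact fields linear in `p` -/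

/-- Polynomials in `q` and `s` only. -/
def pFreePoly : Subalgebra ℝ Obs := MvPolynomial.supported ℝ {0, 2}

theorem mem_pFreePoly {f : Obs} : f ∈ pFreePoly ↔ (1 : Fin 3) ∉ f.vars := by
  rw [pFreePoly, MvPolynomial.mem_supported]
  refine ⟨fun h h1 => by simpa using h (mem_coe.2 h1), fun h i hi => ?_⟩
  fin_cases i
  · simp
  · exact absurd hi h
  · simp

theorem pderiv_one_eq_zero {f : Obs} (hf : f ∈ pFreePoly) : MvPolynomial.pderiv 1 f = 0 :=
  MvPolynomial.pderiv_eq_zero_of_notMem_vars (mem_pFreePoly.1 hf)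

theorem q_mem_pFreePoly : q ∈ pFreePoly := MvPolynomial.X_mem_supported.2 (by simp)

theorem s_mem_pFreePoly : s ∈ pFreePoly := MvPolynomial.X_mem_supported.2 (by simp)

theorem pderiv_mem_pFreePoly (i : Fin 3) {f : Obs} (hf : f ∈ pFreePoly) :
    MvPolynomial.pderiv i f ∈ pFreePoly := by
  rw [pFreePoly, MvPolynomial.supported_eq_adjoin_X] at hf
  induction hf using Algebra.adjoin_induction with
  | mem x hx =>
    obtain ⟨j, -, rfl⟩ := hx
    rw [MvPolynomial.pderiv_X, Pi.single_apply]
    split_ifs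
    · exact pFreePoly.one_mem
    · exact pFreePoly.zero_mem
  | algebraMap r => simp [pFreePoly.zero_mem]
  | add x y _ _ hx hy => rw [map_add]; exact pFreePoly.add_mem hx hy
  | mul x y hx' hy' hx hy =>
    rw [MvPolynomial.pderiv_mul]
    exact pFreePoly.add_mem (pFreePoly.mul_mem hx hy') (pFreePoly.mul_mem hx' hy)

theorem pderiv_comm (i j : Fin 3) (f : Obs) :
    MvPolynomial.pderiv i (MvPolynomial.pderiv j f)
      = MvPolynomial.pderiv j (MvPolynomial.pderiv i f) := by
  have h : ⁅MvPolynomial.pderiv (R := ℝ) i, MvPolynomial.pderiv (R := ℝ) j⁆ = 0 := by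
    refine MvPolynomial.derivation_ext fun k => ?_
    simp only [Derivation.commutator_apply, MvPolynomial.pderiv_X, Pi.single_apply]
    split_ifs <;> simp
  have := congrArg (fun D => D f) h
  simpa [Derivation.commutator_apply, sub_eq_zero] using this

theorem contactVF_apply (H f : Obs) : contactVF H f
    = MvPolynomial.pderiv 1 H * MvPolynomial.pderiv 0 f
      + (-(p * MvPolynomial.pderiv 2 H) - MvPolynomial.pderiv 0 H) * MvPolynomial.pderiv 1 f
      + (p * MvPolynomial.pderiv 1 H - H) * MvPolynomial.pderiv 2 f := rfl

/-- The operator `X_H` as a linear function of `H`. -/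
def contactOp : Obs →ₗ[ℝ] Module.End ℝ Obs where
  toFun H := (contactVF H).toLinearMap
  map_add' H K := by
    refine LinearMap.ext fun f => ?_
    simp [contactVF_apply]
    ring
  map_smul' c H := by
    refine LinearMap.ext fun f => ?_
    simp [contactVF_apply, MvPolynomial.smul_eq_C_mul]
    ring

theorem contactVF_q (H : Obs) : contactVF H q = MvPolynomial.pderiv 1 H := by
  simp [contactVF_apply, MvPolynomial.pderiv_X]

theorem contactVF_p (H : Obs) :
    contactVF H p = -(p * MvPolynomial.pderiv 2 H) - MvPolynomial.pderiv 0 H := by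
  simp [contactVF_apply, MvPolynomial.pderiv_X]

theorem contactVF_s (H : Obs) : contactVF H s = p * MvPolynomial.pderiv 1 H - H := by
  simp [contactVF_apply, MvPolynomial.pderiv_X]

/-- `H` is recovered from its field as `p X_H(q) - X_H(s)`. -/
theorem contactOp_injective : Function.Injective contactOp := by
  intro H K h
  have h0 : contactVF H q = contactVF K q := congrArg (fun D : Module.End ℝ Obs => D q) h
  have h2 : contactVF H s = contactVF K s := congrArg (fun D : Module.End ℝ Obs => D s) h
  rw [contactVF_q, contactVF_q] at h0
  rw [contactVF_s, contactVF_s, h0] at h2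
  exact sub_right_inj.1 h2

/-- Hamiltonians `a p + b` with `a` and `b` polynomials in `q` and `s`. -/
def linearHam : Submodule ℝ Obs where
  carrier := {H | ∃ a ∈ pFreePoly, ∃ b ∈ pFreePoly, H = a * p + b}
  zero_mem' := ⟨0, pFreePoly.zero_mem, 0, pFreePoly.zero_mem, by simp⟩
  add_mem' := by
    rintro _ _ ⟨a, ha, b, hb, rfl⟩ ⟨c, hc, d, hd, rfl⟩
    exact ⟨a + c, pFreePoly.add_mem ha hc, b + d, pFreePoly.add_mem hb hd, by ring⟩
  smul_mem' := by
    rintro r _ ⟨a, ha, b, hb, rfl⟩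
    exact ⟨r • a, pFreePoly.smul_mem ha r, r • b, pFreePoly.smul_mem hb r, by
      rw [smul_add, smul_mul_assoc]⟩

/-- Contact vector fields of Hamiltonians that are linear in `p`. -/
def linearFields : Submodule ℝ (Module.End ℝ Obs) := linearHam.map contactOp

/-- Contact fields are closed under brackets, the Hamiltonian being the Jacobi bracket; for
Hamiltonians linear in `p` its quadratic terms in `p` cancel. Both sides are derivations, so it
suffices to compare them on the coordinates. -/
theorem commutator_contactVF {a b c d : Obs} (ha : a ∈ pFreePoly) (hb : b ∈ pFreePoly)
    (hc : c ∈ pFreePoly) (hd : d ∈ pFreePoly) :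
    ⁅contactVF (a * p + b), contactVF (c * p + d)⁆ = contactVF
      ((a * MvPolynomial.pderiv 0 c - b * MvPolynomial.pderiv 2 c
          - c * MvPolynomial.pderiv 0 a + d * MvPolynomial.pderiv 2 a) * p
        + (a * MvPolynomial.pderiv 0 d - b * MvPolynomial.pderiv 2 d
          - c * MvPolynomial.pderiv 0 b + d * MvPolynomial.pderiv 2 b)) := by
  have h := fun {f : Obs} (hf : f ∈ pFreePoly) => pderiv_one_eq_zero hf
  have h' := fun {f : Obs} (i : Fin 3) (hf : f ∈ pFreePoly) =>
    pderiv_one_eq_zero (pderiv_mem_pFreePoly i hf)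
  refine MvPolynomial.derivation_ext fun i => ?_
  rw [Derivation.commutator_apply]
  fin_cases i
  · change contactVF _ (contactVF _ q) - contactVF _ (contactVF _ q) = contactVF _ q
    simp only [contactVF_q]
    simp [contactVF_apply, MvPolynomial.pderiv_X,
      h ha, h hb, h hc, h hd, h' _ ha, h' _ hb, h' _ hc, h' _ hd]
    ring
  · change contactVF _ (contactVF _ p) - contactVF _ (contactVF _ p) = contactVF _ p
    simp only [contactVF_p]
    simp [contactVF_apply, MvPolynomial.pderiv_X,
      h ha, h hb, h hc, h hd, h' _ ha, h' _ hb, h' _ hc, h' _ hd, pderiv_comm 2 0]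
    ring
  · change contactVF _ (contactVF _ s) - contactVF _ (contactVF _ s) = contactVF _ s
    simp only [contactVF_s]
    simp [contactVF_apply, MvPolynomial.pderiv_X,
      h ha, h hb, h hc, h hd, h' _ ha, h' _ hb, h' _ hc, h' _ hd]
    ring

theorem linearFields_commutatorClosed : CommutatorClosed linearFields := by
  rintro _ ⟨_, ⟨a, ha, b, hb, rfl⟩, rfl⟩ _ ⟨_, ⟨c, hc, d, hd, rfl⟩, rfl⟩
  have hmem := fun {x y z w : Obs} (hx : x ∈ pFreePoly) (hy : y ∈ pFreePoly)
      (hz : z ∈ pFreePoly) (hw : w ∈ pFreePoly) =>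
    pFreePoly.add_mem (pFreePoly.sub_mem (pFreePoly.sub_mem
      (pFreePoly.mul_mem ha (pderiv_mem_pFreePoly 0 hx))
      (pFreePoly.mul_mem hb (pderiv_mem_pFreePoly 2 hy)))
      (pFreePoly.mul_mem hc (pderiv_mem_pFreePoly 0 hz)))
      (pFreePoly.mul_mem hd (pderiv_mem_pFreePoly 2 hw))
  refine ⟨_, ⟨_, hmem hc hc ha ha, _, hmem hd hd hb hb, rfl⟩, ?_⟩
  refine LinearMap.ext fun f => ?_
  exact (congrArg (fun D => D f) (commutator_contactVF ha hb hc hd)).symm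

theorem ham_mem_linearHam (ε : ℝ) (h : Piece) : h.ham ε ∈ linearHam := by
  have hC : ∀ r : ℝ, MvPolynomial.C r ∈ pFreePoly := fun r => pFreePoly.algebraMap_mem r
  cases h with
  | A =>
    exact ⟨0, pFreePoly.zero_mem, _, pFreePoly.neg_mem (pFreePoly.mul_mem (pFreePoly.mul_mem (hC ε)
      (pFreePoly.sub_mem pFreePoly.one_mem (pFreePoly.pow_mem q_mem_pFreePoly 2)))
      s_mem_pFreePoly), by simp [Piece.ham]⟩
  | B => exact ⟨0, pFreePoly.zero_mem, q, q_mem_pFreePoly, by simp [Piece.ham]⟩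
  | C => exact ⟨s, s_mem_pFreePoly, 0, pFreePoly.zero_mem, by simp [Piece.ham, mul_comm]⟩

/-! ### The modified Hamiltonian: existence, uniqueness, leading term, dependence on `p` -/

/-- The exponent `∑ₖ τᵏ⁺¹ X_{Hₖ}` of the formal flow. -/
def flowExponent (H : PowerSeries Obs) : OpSeries :=
  X * PowerSeries.mk fun k => contactOp (coeff k H)

theorem formalFlow_eq (H : PowerSeries Obs) : formalFlow H = formalExp (flowExponent H) := rfl

theorem formalFlow_injective : Function.Injective formalFlow := by
  intro H K h
  have h1 := formalExp_injective (dvd_mul_right _ _) (dvd_mul_right _ _) h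
  ext1 k
  have h2 := congrArg (coeff (k + 1)) h1
  rw [coeff_succ_X_mul, coeff_succ_X_mul, coeff_mk, coeff_mk] at h2
  exact contactOp_injective h2

theorem isGroupLike_lieSeries (S : SplittingIntegrator) (ε : ℝ) :
    IsGroupLike linearFields (S.lieSeries ε) := by
  refine .list_prod linearFields_commutatorClosed _ fun U hU => ?_
  obtain ⟨st, -, rfl⟩ := List.mem_map.1 hU
  refine isGroupLike_formalExp linearFields_commutatorClosed (dvd_mul_right _ _) fun n => ?_
  rcases n with _ | n
  · simp [linearFields.zero_mem]
  · rw [coeff_succ_X_mul, coeff_C]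
    split_ifs
    · exact linearFields.smul_mem _ ⟨_, ham_mem_linearHam ε st.1, rfl⟩
    · exact linearFields.zero_mem

theorem exists_modifiedHamiltonian (S : SplittingIntegrator) (ε : ℝ) :
    ∃ H, IsModifiedHamiltonian ε S H ∧ ∀ k, coeff k H ∈ linearHam := by
  obtain ⟨D, ⟨E, rfl⟩, hDL, hexp⟩ :=
    exists_formalExp_eq linearFields_commutatorClosed (isGroupLike_lieSeries S ε)
  have hE : ∀ k, ∃ H ∈ linearHam, contactOp H = coeff k E := fun k => by
    have := hDL (k + 1)
    rwa [coeff_succ_X_mul] at this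
  choose H hH hHE using hE
  refine ⟨PowerSeries.mk H, ?_, fun k => by simpa using hH k⟩
  have h1 : flowExponent (PowerSeries.mk H) = X * E := by
    rw [flowExponent]
    refine congrArg (X * ·) (PowerSeries.ext fun k => ?_)
    rw [coeff_mk, coeff_mk, hHE]
  rw [IsModifiedHamiltonian, formalFlow_eq, h1, hexp]

theorem coeff_one_formalExp {D : OpSeries} (hD : X ∣ D) : coeff 1 (formalExp D) = coeff 1 D := by
  rw [coeff_formalExp hD (Nat.lt_succ_self 1), expTrunc, sum_range_succ, sum_range_one]
  simp [coeff_one]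

theorem coeff_one_list_prod {ι : Type*} (l : List ι) (f : ι → OpSeries)
    (h : ∀ i ∈ l, constantCoeff (f i) = 1) :
    constantCoeff (l.map f).prod = 1 ∧
      coeff 1 (l.map f).prod = (l.map fun i => coeff 1 (f i)).sum := by
  induction l with
  | nil => simp [coeff_one]
  | cons i l ih =>
    obtain ⟨h0, h1⟩ := ih fun j hj => h j (by simp [hj])
    have hi := h i (by simp)
    simp only [List.map_cons, List.prod_cons, List.sum_cons]
    refine ⟨by rw [map_mul, hi, h0, one_mul], ?_⟩
    rw [coeff_mul, Nat.sum_antidiagonal_eq_sum_range_succ_mk, sum_range_succ, sum_range_one]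
    simp [hi, h0, h1, add_comm]

theorem coeff_one_lieSeries (S : SplittingIntegrator) (ε : ℝ) :
    coeff 1 (S.lieSeries ε) = contactOp (vdpHam ε) := by
  rw [SplittingIntegrator.lieSeries,
    (coeff_one_list_prod _ _ fun _ _ => constantCoeff_formalExp _).2]
  have h1 : ∀ st : Piece × ℝ, coeff 1 (formalExp
      (X * PowerSeries.C (st.2 • (contactVF (st.1.ham ε)).toLinearMap)))
      = st.2 • contactOp (st.1.ham ε) := fun st => by
    rw [coeff_one_formalExp (dvd_mul_right _ _), ← zero_add 1, coeff_succ_X_mul, coeff_zero_C]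
    rfl
  simp only [h1]
  -- Grouping the first-order terms by piece exposes exactly the sums that consistency fixes to `1`.
  have h2 : ∀ l : List (Piece × ℝ), (l.map fun st => st.2 • contactOp (st.1.ham ε)).sum
      = (l.map fun st => if st.1 = .A then st.2 else 0).sum • contactOp (Piece.ham ε .A)
        + (l.map fun st => if st.1 = .B then st.2 else 0).sum • contactOp (Piece.ham ε .B)
        + (l.map fun st => if st.1 = .C then st.2 else 0).sum • contactOp (Piece.ham ε .C) := by
    intro l
    induction l with
    | nil => simp
    | cons st l ih =>
      obtain ⟨h, c⟩ := st
      simp only [List.map_cons, List.sum_cons, ih]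
      cases h <;> simp [add_smul] <;> abel
  rw [h2, S.consistent, S.consistent, S.consistent, one_smul, one_smul, one_smul, ← map_add,
    ← map_add]
  congr 1
  simp only [Piece.ham, vdpHam]
  ring

theorem IsModifiedHamiltonian.coeff_zero {ε : ℝ} {S : SplittingIntegrator} {H : PowerSeries Obs}
    (h : IsModifiedHamiltonian ε S H) : coeff 0 H = vdpHam ε := by
  have h1 := congrArg (coeff 1) h
  rw [formalFlow_eq, flowExponent, coeff_one_formalExp (dvd_mul_right _ _), coeff_one_lieSeries,
    ← zero_add 1, coeff_succ_X_mul, coeff_mk] at h1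
  exact contactOp_injective h1

theorem pderiv_one_linear {a b : Obs} (ha : a ∈ pFreePoly) (hb : b ∈ pFreePoly) :
    MvPolynomial.pderiv 1 (a * p + b) = a := by
  simp [pderiv_one_eq_zero ha, pderiv_one_eq_zero hb]

theorem linearInP_of_forall_mem {H : PowerSeries Obs} (h : ∀ k, coeff k H ∈ linearHam)
    (h0 : MvPolynomial.pderiv 1 (coeff 0 H) ≠ 0) : LinearInP H := by
  choose a ha b hb hab using h
  refine ⟨PowerSeries.mk a, PowerSeries.mk b, fun k => by simpa using mem_pFreePoly.1 (ha k),
    fun k => by simpa using mem_pFreePoly.1 (hb k), fun h => h0 ?_, ?_⟩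
  · rw [hab, pderiv_one_linear (ha 0) (hb 0)]
    simpa using congrArg (coeff 0) h
  · ext1 k
    simp [hab]

theorem pFree_modifiedRHS_q {H : PowerSeries Obs} (h : ∀ k, coeff k H ∈ linearHam) :
    PFree (modifiedRHS H q) := fun k => by
  obtain ⟨a, ha, b, hb, hab⟩ := h k
  rw [modifiedRHS, coeff_mk, contactVF_q, hab, pderiv_one_linear ha hb]
  exact mem_pFreePoly.1 ha

theorem pFree_modifiedRHS_s {H : PowerSeries Obs} (h : ∀ k, coeff k H ∈ linearHam) :
    PFree (modifiedRHS H s) := fun k => by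
  obtain ⟨a, ha, b, hb, hab⟩ := h k
  rw [modifiedRHS, coeff_mk, contactVF_s, hab, pderiv_one_linear ha hb,
    show p * a - (a * p + b) = -b by ring]
  exact mem_pFreePoly.1 (pFreePoly.neg_mem hb)

theorem pderiv_one_vdpHam (ε : ℝ) : MvPolynomial.pderiv 1 (vdpHam ε) = s := by
  simp [vdpHam, MvPolynomial.pderiv_X]

/-! ### Asymptotic expansion of the numerical map -/

theorem eventually_flow_defined (x : Fin 3 → ℝ) :
    ∀ᶠ z : ℝ × (Fin 3 → ℝ) in 𝓝 (0, x), 1 + z.2 1 * z.1 ≠ 0 := by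
  have h : Continuous fun z : ℝ × (Fin 3 → ℝ) => 1 + z.2 1 * z.1 := by fun_prop
  exact h.continuousAt.eventually_ne (by simp)

theorem continuousAt_flow (ε : ℝ) (h : Piece) (x : Fin 3 → ℝ) :
    ContinuousAt (fun z : ℝ × (Fin 3 → ℝ) => h.flow ε z.1 z.2) (0, x) := by
  refine continuousAt_pi.2 fun i => ?_
  cases h with
  | A => fin_cases i <;> simp [Piece.flow] <;> fun_prop
  | B => fin_cases i <;> simp [Piece.flow] <;> fun_prop
  | C =>
    fin_cases i
    · simp [Piece.flow]; fun_prop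
    · simp only [Piece.flow]
      exact ContinuousAt.div (by fun_prop) (by fun_prop) (by simp)
    · simp [Piece.flow]; fun_prop

/-- Chain rule for a polynomial along a solution curve of a polynomial vector field. -/
theorem hasDerivAt_eval {D : Derivation ℝ Obs Obs} {γ : ℝ → Fin 3 → ℝ} {t : ℝ}
    (hγ : ∀ i, HasDerivAt (fun u => γ u i) (MvPolynomial.eval (γ t) (D (MvPolynomial.X i))) t)
    (f : Obs) :
    HasDerivAt (fun u => MvPolynomial.eval (γ u) f) (MvPolynomial.eval (γ t) (D f)) t := by
  induction f using MvPolynomial.induction_on with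
  | C a => simpa using hasDerivAt_const t a
  | add f g hf hg => simpa using! hf.add hg
  | mul_X f i hf =>
    have := hf.mul (hγ i)
    simp only [map_mul, MvPolynomial.eval_X, Derivation.leibniz, smul_eq_mul, map_add]
    refine this.congr_deriv ?_
    ring

/-- The Taylor polynomial in `t` of `f` along the flow of a linear operator `D`. -/
def taylorFlow (D : Module.End ℝ Obs) (N : ℕ) (f : Obs) (t : ℝ) (y : Fin 3 → ℝ) : ℝ :=
  ∑ k ∈ range N, t ^ k * ((k.factorial : ℝ)⁻¹ * MvPolynomial.eval y ((D ^ k) f))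

theorem hasDerivAt_taylorFlow (D : Module.End ℝ Obs) (N : ℕ) (f : Obs) (t : ℝ) (y : Fin 3 → ℝ) :
    HasDerivAt (fun u => taylorFlow D (N + 1) f u y) (taylorFlow D N (D f) t y) t := by
  have key : ∀ k ∈ range N, HasDerivAt
      (fun u : ℝ => u ^ (k + 1) * (((k + 1).factorial : ℝ)⁻¹ *
        MvPolynomial.eval y ((D ^ (k + 1)) f)))
      (t ^ k * ((k.factorial : ℝ)⁻¹ * MvPolynomial.eval y ((D ^ k) (D f)))) t := fun k _ => by
    refine ((hasDerivAt_pow (k + 1) t).mul_const _).congr_deriv ?_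
    rw [Nat.factorial_succ, pow_succ D, Module.End.mul_apply]
    push_cast
    have : (k.factorial : ℝ) ≠ 0 := by positivity
    field_simp
  simp only [taylorFlow, sum_range_succ' _ N, pow_zero]
  exact (HasDerivAt.fun_sum key).add_const _

/-- The time derivative of the remainder of order `N + 1` for `f` is the remainder of order `N` for
`X_h f`, so the mean value inequality gains one power of `t`. The estimate is joint in `(t, y)`
because later stages start from a point that moves with `τ`. -/
theorem flow_taylor_isBigO (ε : ℝ) (h : Piece) (x : Fin 3 → ℝ) (N : ℕ) (f : Obs) :
    (fun z : ℝ × (Fin 3 → ℝ) => MvPolynomial.eval (h.flow ε z.1 z.2) f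
      - taylorFlow (contactOp (h.ham ε)) N f z.1 z.2) =O[𝓝 (0, x)] fun z => z.1 ^ N := by
  induction N generalizing f with
  | zero =>
    simp only [taylorFlow, range_zero, sum_empty, sub_zero, pow_zero]
    have h1 := ContinuousAt.comp (g := fun y => MvPolynomial.eval y f)
      (MvPolynomial.continuous_eval f).continuousAt (continuousAt_flow ε h x)
    exact h1.norm.isBoundedUnder_le.isBigO_one ℝ
  | succ N ih =>
    obtain ⟨c, hc0, hc⟩ := (ih (contactOp (h.ham ε) f)).exists_nonneg
    -- The ball is chosen so that the bound holds and the local flow of `C` is defined at all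
    -- intermediate times.
    obtain ⟨δ, hδ, hball⟩ :=
      Metric.eventually_nhds_iff_ball.1 (hc.bound.and (eventually_flow_defined x))
    refine IsBigO.of_bound c ?_
    filter_upwards [Metric.ball_mem_nhds _ hδ] with z hz
    obtain ⟨t, y⟩ := z
    have hmem : ∀ u ∈ Metric.closedBall (0 : ℝ) |t|, (u, y) ∈ Metric.ball ((0 : ℝ), x) δ := by
      intro u hu
      simp only [Metric.mem_ball, Prod.dist_eq, max_lt_iff, dist_zero_right, Real.norm_eq_abs,
        Metric.mem_closedBall] at hz hu ⊢
      exact ⟨hu.trans_lt hz.1, hz.2⟩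
    set g : ℝ → ℝ := fun u => MvPolynomial.eval (h.flow ε u y) f
      - taylorFlow (contactOp (h.ham ε)) (N + 1) f u y with hg
    have hderiv : ∀ u ∈ Metric.closedBall (0 : ℝ) |t|, HasDerivWithinAt g
        (MvPolynomial.eval (h.flow ε u y) (contactOp (h.ham ε) f)
          - taylorFlow (contactOp (h.ham ε)) N (contactOp (h.ham ε) f) u y)
        (Metric.closedBall (0 : ℝ) |t|) u := fun u hu =>
      ((hasDerivAt_eval (fun i => h.hasDerivAt_flow ε y u (fun _ => (hball _ (hmem u hu)).2) i)
        f).sub (hasDerivAt_taylorFlow _ N f u y)).hasDerivWithinAt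
    have hbound : ∀ u ∈ Metric.closedBall (0 : ℝ) |t|,
        ‖MvPolynomial.eval (h.flow ε u y) (contactOp (h.ham ε) f)
          - taylorFlow (contactOp (h.ham ε)) N (contactOp (h.ham ε) f) u y‖
          ≤ c * |t| ^ N := fun u hu => by
      refine (hball _ (hmem u hu)).1.trans ?_
      simp only [norm_pow, Real.norm_eq_abs]
      have hu' : |u| ≤ |t| := by simpa using hu
      gcongr
    have h0 : g 0 = 0 := by
      simp [hg, taylorFlow, sum_range_succ', Piece.flow_zero]
    have := Convex.norm_image_sub_le_of_norm_hasDerivWithin_le hderiv hbound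
      (convex_closedBall _ _) (x := 0) (y := t) (by simp) (by simp)
    rw [h0, sub_zero, sub_zero] at this
    refine this.trans (le_of_eq ?_)
    rw [Real.norm_eq_abs, Real.norm_eq_abs, abs_pow, pow_succ, mul_assoc]

theorem coeff_formalExp_X_mul_C (w : Module.End ℝ Obs) (k : ℕ) :
    coeff k (formalExp (X * PowerSeries.C w)) = ((k.factorial : ℝ)⁻¹) • w ^ k := by
  have h : ∀ n, coeff k ((X * PowerSeries.C w : OpSeries) ^ n) = if k = n then w ^ n else 0 := by
    intro n
    have hX : Commute (X : OpSeries) (PowerSeries.C w) := (commute_X _).symm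
    rw [hX.mul_pow, coeff_X_pow_mul', ← map_pow, coeff_C]
    by_cases hkn : k = n
    · simp [hkn]
    · rw [if_neg hkn]
      split_ifs
      · omega
      · rfl
      · rfl
  simp only [formalExp, coeff_mk, h]
  rw [sum_eq_single k] <;> simp +contextual [eq_comm]

/-- The new map acts last on points, hence its pull-back acts first on functions and stands
rightmost. Taylor expansion at the moving point `Φ τ x` leaves polynomials `Dᵏ f`, to which the
expansion of `Φ` applies. -/
theorem IsExpansionOf.comp_flow {T : OpSeries} {Φ : ℝ → (Fin 3 → ℝ) → (Fin 3 → ℝ)}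
    (hT : IsExpansionOf T Φ) (hΦ : ∀ x, Tendsto (fun τ => Φ τ x) (𝓝 0) (𝓝 x))
    (ε c : ℝ) (h : Piece) :
    IsExpansionOf (T * formalExp (X * PowerSeries.C (c • (contactVF (h.ham ε)).toLinearMap)))
      fun τ x => h.flow ε (c * τ) (Φ τ x) := by
  intro f x N
  set D := contactOp (h.ham ε) with hD
  have hlim : Tendsto (fun τ => (c * τ, Φ τ x)) (𝓝 0) (𝓝 ((0 : ℝ), x)) := by
    refine Tendsto.prodMk_nhds ?_ (hΦ x)
    simpa using (tendsto_id (α := ℝ) (x := 𝓝 0)).const_mul c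
  have h1 : (fun τ : ℝ => MvPolynomial.eval (h.flow ε (c * τ) (Φ τ x)) f
      - taylorFlow D N f (c * τ) (Φ τ x)) =O[𝓝 0] fun τ => τ ^ N := by
    refine ((flow_taylor_isBigO ε h x N f).comp_tendsto hlim).trans ?_
    simp only [Function.comp_def, mul_pow]
    exact isBigO_const_mul_self _ _ _
  -- The prefactor already supplies `τᵏ`, so expanding `Dᵏ f` to order `N - k` is enough.
  have h2 : ∀ k ∈ range N, (fun τ : ℝ => (c * τ) ^ k * ((k.factorial : ℝ)⁻¹ *
      (MvPolynomial.eval (Φ τ x) ((D ^ k) f) - ∑ j ∈ range (N - k),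
        τ ^ j * MvPolynomial.eval x (coeff j T ((D ^ k) f))))) =O[𝓝 0] fun τ => τ ^ N := by
    intro k hk
    have hk' : k + (N - k) = N := by have := mem_range.1 hk; omega
    have h3 : (fun τ : ℝ => (c * τ) ^ k) =O[𝓝 0] fun τ => τ ^ k := by
      simp only [mul_pow]
      exact isBigO_const_mul_self _ _ _
    have h4 := h3.mul ((hT ((D ^ k) f) x (N - k)).const_mul_left ((k.factorial : ℝ)⁻¹))
    simpa only [← pow_add, hk'] using h4
  refine (h1.add (IsBigO.fun_sum h2)).congr_left fun τ => ?_
  simp only [mul_sub, sum_sub_distrib, taylorFlow]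
  rw [sub_add_sub_cancel]
  congr 1
  have h5 : ∀ n, MvPolynomial.eval x (coeff n (T * formalExp (X * PowerSeries.C (c • D))) f)
      = ∑ k ∈ range (n + 1), c ^ k * ((k.factorial : ℝ)⁻¹ *
        MvPolynomial.eval x (coeff (n - k) T ((D ^ k) f))) := by
    intro n
    rw [coeff_mul, ← Nat.sum_antidiagonal_swap, LinearMap.sum_apply, map_sum,
      ← Nat.sum_antidiagonal_eq_sum_range_succ (fun k j => c ^ k * ((k.factorial : ℝ)⁻¹ *
        MvPolynomial.eval x (coeff j T ((D ^ k) f))))]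
    refine sum_congr rfl fun ij _ => ?_
    simp only [Prod.fst_swap, Prod.snd_swap, coeff_formalExp_X_mul_C, Module.End.mul_apply,
      smul_pow, LinearMap.smul_apply, map_smul, MvPolynomial.smul_eval]
    ring
  refine Eq.trans ?_ (sum_congr rfl fun n _ => congrArg (τ ^ n * ·) (h5 n).symm)
  simp only [mul_sum]
  -- The triangular double sum is regrouped by total degree `n = k + j`, matching the Cauchy
  -- product.
  rw [← sum_range_diag_flip N (fun k j => (c * τ) ^ k * ((k.factorial : ℝ)⁻¹ *
    (τ ^ j * MvPolynomial.eval x (coeff j T ((D ^ k) f)))))]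
  refine sum_congr rfl fun n _ => sum_congr rfl fun k hk => ?_
  obtain ⟨j, rfl⟩ : ∃ j, n = k + j := ⟨n - k, by have := mem_range.1 hk; omega⟩
  rw [Nat.add_sub_cancel_left]
  ring

theorem isExpansionOf_stages (ε : ℝ) (l : List (Piece × ℝ)) :
    IsExpansionOf (l.map fun st => formalExp
        (X * PowerSeries.C (st.2 • (contactVF (st.1.ham ε)).toLinearMap))).prod
      (fun τ x => l.foldl (fun y st => st.1.flow ε (st.2 * τ) y) x) ∧
    ∀ x, Tendsto (fun τ => l.foldl (fun y st => st.1.flow ε (st.2 * τ) y) x) (𝓝 0) (𝓝 x) := by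
  -- Stages are peeled off the end because both the fold and the operator product grow there.
  induction l using List.reverseRecOn with
  | nil =>
    refine ⟨fun f x N => ?_, fun x => tendsto_const_nhds⟩
    rcases N with _ | N
    · simpa using isBigO_const_const (MvPolynomial.eval x f) (one_ne_zero (α := ℝ)) _
    · refine IsBigO.congr_left (isBigO_zero _ _) fun τ => ?_
      simp [sum_range_succ', coeff_one]
  | append_singleton l st ih =>
    simp only [List.map_append, List.map_cons, List.map_nil, List.prod_append, List.prod_cons,
      List.prod_nil, mul_one, List.foldl_append, List.foldl_cons, List.foldl_nil]
    refine ⟨ih.1.comp_flow ih.2 ε st.2 st.1, fun x => ?_⟩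
    have h := continuousAt_flow ε st.1 x
    rw [ContinuousAt, Piece.flow_zero] at h
    refine h.comp (Tendsto.prodMk_nhds ?_ (ih.2 x))
    simpa using (tendsto_id (α := ℝ) (x := 𝓝 0)).const_mul st.2

end

end ContactVdP

theorem mainTheorem3 (ε : ℝ) (S : ContactVdP.SplittingIntegrator) :
    (∃! H : PowerSeries ContactVdP.Obs, ContactVdP.IsModifiedHamiltonian ε S H) ∧
    ∀ H : PowerSeries ContactVdP.Obs, ContactVdP.IsModifiedHamiltonian ε S H →
      ContactVdP.IsExpansionOf (ContactVdP.formalFlow H) (S.step ε) ∧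
      PowerSeries.coeff 0 H = ContactVdP.vdpHam ε ∧
      ContactVdP.LinearInP H ∧
      ContactVdP.PFree (ContactVdP.modifiedRHS H ContactVdP.q) ∧
      ContactVdP.PFree (ContactVdP.modifiedRHS H ContactVdP.s) := by
  obtain ⟨K, hK, hlin⟩ := ContactVdP.exists_modifiedHamiltonian S ε
  have huniq : ∀ H, ContactVdP.IsModifiedHamiltonian ε S H → H = K := fun H hH =>
    ContactVdP.formalFlow_injective (hH.trans hK.symm)
  refine ⟨⟨K, hK, huniq⟩, fun H hH => ?_⟩
  obtain rfl := huniq H hH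
  refine ⟨?_, hH.coeff_zero, ContactVdP.linearInP_of_forall_mem hlin ?_,
    ContactVdP.pFree_modifiedRHS_q hlin, ContactVdP.pFree_modifiedRHS_s hlin⟩
  · rw [show ContactVdP.formalFlow H = S.lieSeries ε from hH]
    exact (ContactVdP.isExpansionOf_stages ε S.stages).1
  · rw [hH.coeff_zero, ContactVdP.pderiv_one_vdpHam]
    exact MvPolynomial.X_ne_zero 2
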